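/- Let $n\ge 1$ be an integer, let $\kappa>1$, put $\rho=(\kappa-1)/(\kappa+1)\in(0,1)$, and let $M_\rho\in\mathbb{R}^{n\times n}$ be the matrix whose first row is $(\rho/n,\dots,\rho/n)$, whose subdiagonal entries are $1$, and whose other entries are $0$. Let $\lambda^*(\rho)$ be the spectral radius of $M_\rho$ (the largest modulus of a complex eigenvalue) and $T(\lambda)=\det(\lambda I-M_\rho)$ its characteristic polynomial. Then: (i) $\lambda^*(\rho)$ is the largest real root of $T$, and it is a simple root of $T$. (ii) Let $(d^k)_{k\ge0}$ be any sequence with $d^{k+1}=\rho\,(d^k+d^{k-1}+\dots+d^{k-n+1})/n$ for all $k\ge n-1$, whose initial values $d^0,\dots,d^{n-1}$ are nonnegative and not all zero. Then $\lim_{k\to\infty} d^{k+1}/d^k=\lambda^*(\rho)$. (iii) If $n>1$, then $\rho\le\lambda^*(\rho)<\rho^{1/n}$; in particular $\lambda^*(\rho)^n<\rho$. (iv) $\lambda^*(\rho)=\gamma_0$, where $\gamma_0$ is the largest (and in fact the unique) root in $[0,1)$ of $h(\gamma)=\gamma^{n+1}-(1+\rho/n)\gamma^n+\rho/n$. Moreover,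 let $f_1,\dots,f_n:\mathbb{R}^p\to\mathbb{R}$ be differentiable with $(\nabla f_i(x)-\nabla f_i(y))^T(x-y)\ge\mu\|x-y\|^2$ and $\|\nabla f_i(x)-\nabla f_i(y)\|\le L\|x-y\|$ for all $x,y$, where $\mu>0$ and $L/\mu=\kappa$; let $x^*$ be the minimizer of $\frac1n\sum_i f_i$, let $\varepsilon=2/(\mu+L)$, and let $(x^k)$ be the iterates of the double incremental aggregated gradient (DIAG) method: $y_1^0=\dots=y_n^0=x^0$, $x^{k+1}=\frac1n\sum_i y_i^k-\frac{\varepsilon}{n}\sum_i\nabla f_i(y_i^k)$, $y_i^{k+1}=x^{k+1}$ for $i=(k \bmod n)+1$, and $y_i^{k+1}=y_i^k$ for the other $i$. If $(d^k)$ satisfies the recurrence in (ii) with $d^j=\|x^j-x^*\|$ for $0\le j\le n-1$, then $\|x^k-x^*\|\le d^k$ for all $k\ge0$, and if $x^0\ne x^*$ then $d^{k+1}/d^k\to\lambda^*(\rho)$. Hence, for $n>1$, the asymptotic worst-case factor $\lambda^*(\rho)^n$ of one pass ($n$ iterations) of DIAG is strictly smaller than the factor $\rho$ of one gradient descent iteration.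 -/

import Mathlib

open Filter Topology Polynomial

/-- The `n × n` matrix whose first row is constant equal to `ρ / n`, with ones on the
subdiagonal and zeros elsewhere. -/
noncomputable def recMatrix (n : ℕ) (ρ : ℝ) : Matrix (Fin n) (Fin n) ℝ :=
  Matrix.of fun i j =>
    if i.val = 0 then ρ / n else if i.val = j.val + 1 then 1 else 0

/-- The spectral radius (largest modulus of a complex eigenvalue) of a real square matrix,
as a real number. The spectrum of a matrix is finite, so nothing is lost by `ENNReal.toReal`. -/
noncomputable def matSpectralRadius {n : ℕ} (A : Matrix (Fin n) (Fin n) ℝ) : ℝ :=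
  (spectralRadius ℂ (A.map (algebraMap ℝ ℂ))).toReal

/-- The recurrence `d^{k+1} = ρ (d^k + d^{k-1} + ⋯ + d^{k-n+1}) / n` for `k ≥ n - 1`,
written with `m = k - n + 1`. -/
def IsAveragingSeq (n : ℕ) (ρ : ℝ) (d : ℕ → ℝ) : Prop :=
  ∀ m : ℕ, d (m + n) = ρ * ((∑ j ∈ Finset.range n, d (m + j)) / n)

/-- The polynomial function `h(γ) = γ^{n+1} - (1 + ρ/n) γ^n + ρ/n`. -/
noncomputable def hFun (n : ℕ) (ρ γ : ℝ) : ℝ :=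
  γ ^ (n + 1) - (1 + ρ / n) * γ ^ n + ρ / n

/-- `f` is differentiable, strongly convex with constant `μ` (monotonicity form), and its
gradient is Lipschitz with constant `L`, on Euclidean `p`-space. -/
structure IsSmoothStronglyConvex {p : ℕ} (μ L : ℝ) (f : EuclideanSpace ℝ (Fin p) → ℝ) :
    Prop where
  differentiable : Differentiable ℝ f
  strong : ∀ x y, μ * ‖x - y‖ ^ 2 ≤ inner ℝ (gradient f x - gradient f y) (x - y)
  lipschitz : ∀ x y, ‖gradient f x - gradient f y‖ ≤ L * ‖x - y‖

/-- The state of the double incremental aggregated gradient method after `k` steps: the iterate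
`x^k` and the stored copies `y_1^k, …, y_n^k`, all of them `x^0` at the start. Step `k` computes
`x^{k+1} = (1/n) ∑ y_i^k - (ε/n) ∑ ∇f_i(y_i^k)` and stores it in the copy with (zero-based)
index `k mod n`. -/
noncomputable def diagState {n p : ℕ} (f : Fin n → EuclideanSpace ℝ (Fin p) → ℝ) (ε : ℝ)
    (x₀ : EuclideanSpace ℝ (Fin p)) :
    ℕ → EuclideanSpace ℝ (Fin p) × (Fin n → EuclideanSpace ℝ (Fin p))
  | 0 => (x₀, fun _ => x₀)
  | k + 1 =>
    let y := (diagState f ε x₀ k).2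
    let x := (1 / (n : ℝ)) • ∑ i, y i - (ε / (n : ℝ)) • ∑ i, gradient (f i) (y i)
    (x, fun i => if i.val = k % n then x else y i)

/-- The iterate `x^k` of the double incremental aggregated gradient method. -/
noncomputable def diagIterate {n p : ℕ} (f : Fin n → EuclideanSpace ℝ (Fin p) → ℝ) (ε : ℝ)
    (x₀ : EuclideanSpace ℝ (Fin p)) (k : ℕ) : EuclideanSpace ℝ (Fin p) :=
  (diagState f ε x₀ k).1

/-! With `c = ρ / n`, the characteristic polynomial is `T(t) = t ^ n - c (1 + ⋯ + t ^ (n - 1))`, and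
`h(t) = (t - 1) T(t)`. On positive reals `t ^ n / (1 + ⋯ + t ^ (n - 1))` is strictly increasing, so
`T` has just one positive root `r`, and `r < 1` since `T(0) < 0 < T(1)`. By the triangle inequality
the modulus of every complex root is at most `r` (`le_of_pow_le_geom_sum`), so `r` is the spectral
radius.

For the ratio limit, each term of `d k / r ^ k` is a weighted average of its `n` predecessors with
fixed positive weights. Such a sequence converges (`exists_tendsto_of_weighted_average`), here to a
positive limit.

For the method, a gradient step of length `2 / (μ + L)` contracts by `ρ` (`norm_gradient_step_le`),
and the stored copies eventually are the last `n` iterates. The errors thus satisfy the recurrence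
as an inequality, and `d` dominates them by induction. -/

/-! ### Characteristic polynomial -/

/-- Expansion along the last column, where only the top and bottom entries survive, gives `T_{n+1} =
X * T_n - c`. Size one is separate because there these two entries coincide. -/
theorem Matrix.charpoly_const_top_row {R : Type*} [CommRing R] (c : R) (n : ℕ) :
    (Matrix.of fun i j : Fin n =>
      if i.val = 0 then c else if i.val = j.val + 1 then (1 : R) else 0).charpoly =
      X ^ n - C c * ∑ j ∈ Finset.range n, X ^ j := by
  induction n with
  | zero => simp [Matrix.charpoly]
  | succ n ih =>
    rcases n with _ | m
    · simp [Matrix.charpoly]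
    · rw [Matrix.charpoly, Matrix.det_succ_column _ (Fin.last (m + 1)), Fin.sum_univ_succ,
        Fin.sum_univ_castSucc]
      have hmid : ∀ i : Fin m, (-1 : R[X]) ^ ((i.castSucc.succ : Fin (m + 2)).val +
          (Fin.last (m + 1)).val) *
          (Matrix.charmatrix (Matrix.of fun i j : Fin (m + 2) =>
            if i.val = 0 then c else if i.val = j.val + 1 then (1 : R) else 0))
              i.castSucc.succ (Fin.last (m + 1)) *
          ((Matrix.charmatrix (Matrix.of fun i j : Fin (m + 2) =>
            if i.val = 0 then c else if i.val = j.val + 1 then (1 : R) else 0)).submatrix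
              (i.castSucc.succ).succAbove (Fin.last (m + 1)).succAbove).det = 0 := by
        intro i
        have h1 : (i.castSucc.succ : Fin (m + 2)) ≠ Fin.last (m + 1) := by
          intro h
          have := congrArg Fin.val h
          simp at this
          omega
        have h2 : i.val ≠ m + 1 := by omega
        rw [Matrix.charmatrix_apply_ne _ _ _ h1]
        simp [h2]
      rw [Finset.sum_eq_zero (fun i _ => hmid i)]
      have hfirst : ((Matrix.charmatrix (Matrix.of fun i j : Fin (m + 2) =>
            if i.val = 0 then c else if i.val = j.val + 1 then (1 : R) else 0)).submatrix
              (0 : Fin (m + 2)).succAbove (Fin.last (m + 1)).succAbove).det = (-1) ^ (m + 1) := by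
        rw [Matrix.det_of_isUpperTriangular]
        · rw [Finset.prod_congr rfl (g := fun _ => (-1 : R[X]))]
          · simp
          · intro i _
            have : (i.succ : Fin (m + 2)) ≠ i.castSucc := by
              intro h
              have := congrArg Fin.val h
              simp at this
            simp [Matrix.charmatrix_apply_ne _ _ _ this]
        · intro i j hij
          have hij' : j.val < i.val := hij
          have : (i.succ : Fin (m + 2)) ≠ j.castSucc := by
            intro h
            have := congrArg Fin.val h
            simp at this
            omega
          simp [Matrix.charmatrix_apply_ne _ _ _ this, hij'.ne']
      have hlast : ((Matrix.charmatrix (Matrix.of fun i j : Fin (m + 2) =>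
            if i.val = 0 then c else if i.val = j.val + 1 then (1 : R) else 0)).submatrix
              (Fin.last (m + 1)).succAbove (Fin.last (m + 1)).succAbove).det =
            X ^ (m + 1) - C c * ∑ j ∈ Finset.range (m + 1), X ^ j := by
        rw [← ih, Matrix.charpoly]
        congr 1
        ext1 i j
        simp [Matrix.charmatrix_apply, Matrix.diagonal_apply]
      have hsign : (-1 : R[X]) ^ (m + 1) * (-1) ^ (m + 1) = 1 := by
        rw [← mul_pow]; simp
      have hsign2 : (-1 : R[X]) ^ (m + 1 + (m + 1)) = 1 := by rw [pow_add, hsign]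
      have h0 : (0 : Fin (m + 2)) ≠ Fin.last (m + 1) := by
        intro h
        have := congrArg Fin.val h
        simp at this
      rw [Fin.succ_last, hfirst, hlast, Matrix.charmatrix_apply_ne _ _ _ h0,
        Matrix.charmatrix_apply_eq, geom_sum_succ (n := m + 1)]
      simp only [Fin.val_zero, Fin.val_last, zero_add, Matrix.of_apply, if_true, hsign2]
      simp only [Nat.succ_eq_add_one, Nat.add_eq_zero_iff, one_ne_zero, and_false, if_false,
        Nat.left_eq_add, map_zero]
      linear_combination (-C c) * hsign

theorem recMatrix_charpoly (n : ℕ) (ρ : ℝ) :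
    (recMatrix n ρ).charpoly = X ^ n - C (ρ / n) * ∑ j ∈ Finset.range n, X ^ j :=
  Matrix.charpoly_const_top_row _ n

theorem recMatrix_isRoot_iff {n : ℕ} {ρ t : ℝ} :
    (recMatrix n ρ).charpoly.IsRoot t ↔ t ^ n = ρ / n * ∑ j ∈ Finset.range n, t ^ j := by
  simp [recMatrix_charpoly, IsRoot.def, eval_finsetSum, sub_eq_zero]

theorem recMatrix_map_isRoot_iff {n : ℕ} {ρ : ℝ} {z : ℂ} :
    ((recMatrix n ρ).map (algebraMap ℝ ℂ)).charpoly.IsRoot z ↔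
      z ^ n = (ρ / n : ℝ) * ∑ j ∈ Finset.range n, z ^ j := by
  have : ((recMatrix n ρ).map (algebraMap ℝ ℂ)).charpoly =
      ((recMatrix n ρ).charpoly).map (algebraMap ℝ ℂ) := Matrix.charpoly_map _ _
  rw [this, recMatrix_charpoly]
  simp [IsRoot.def, eval_finsetSum, sub_eq_zero, Polynomial.map_sum]

/-! ### The positive root and the spectral radius -/

theorem hFun_eq (n : ℕ) (ρ t : ℝ) :
    hFun n ρ t = (t - 1) * (t ^ n - ρ / n * ∑ j ∈ Finset.range n, t ^ j) := by
  have := geom_sum_mul t n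
  unfold hFun
  linear_combination (ρ / n) * this

/-- A nonnegative `t` with `t ^ n ≤ c (1 + t + ⋯ + t ^ (n - 1))` is at most the positive root. -/
theorem le_of_pow_le_geom_sum {n : ℕ} {c r t : ℝ} (hn : 1 ≤ n) (hc : 0 < c) (hr : 0 < r)
    (hroot : r ^ n = c * ∑ j ∈ Finset.range n, r ^ j)
    (h : t ^ n ≤ c * ∑ j ∈ Finset.range n, t ^ j) : t ≤ r := by
  by_contra! hlt
  have ht : 0 < t := hr.trans hlt
  -- Monotonicity of `t ^ n / ∑ t ^ j` with denominators cleared, compared term by term.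
  have hsum : ∑ j ∈ Finset.range n, t ^ j * r ^ n < ∑ j ∈ Finset.range n, t ^ n * r ^ j := by
    refine Finset.sum_lt_sum_of_nonempty (Finset.nonempty_range_iff.2 (by omega)) fun j hj => ?_
    obtain ⟨k, rfl⟩ := Nat.exists_eq_add_of_lt (Finset.mem_range.1 hj)
    have h1 : r ^ (k + 1) < t ^ (k + 1) := pow_lt_pow_left₀ hlt hr.le (by omega)
    have h2 : 0 < t ^ j * r ^ j := by positivity
    calc t ^ j * r ^ (j + k + 1) = t ^ j * r ^ j * r ^ (k + 1) := by ring
      _ < t ^ j * r ^ j * t ^ (k + 1) := by gcongr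
      _ = t ^ (j + k + 1) * r ^ j := by ring
  rw [← Finset.sum_mul, ← Finset.mul_sum] at hsum
  have h3 := mul_le_mul_of_nonneg_right h (pow_pos hr n).le
  have h4 := mul_lt_mul_of_pos_left hsum hc
  have h5 : t ^ n * r ^ n = c * (t ^ n * ∑ j ∈ Finset.range n, r ^ j) := by rw [hroot]; ring
  linarith

theorem exists_pow_eq_geom_sum {n : ℕ} {c : ℝ} (hn : 1 ≤ n) (hc : 0 < c) (hcn : n * c < 1) :
    ∃ r, 0 < r ∧ r < 1 ∧ r ^ n = c * ∑ j ∈ Finset.range n, r ^ j := by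
  have hcont : ContinuousOn (fun t : ℝ => t ^ n - c * ∑ j ∈ Finset.range n, t ^ j)
      (Set.Icc 0 1) := by fun_prop
  obtain ⟨r, ⟨h0, h1⟩, hr⟩ := intermediate_value_Ioo zero_le_one hcont (show (0 : ℝ) ∈ _ by
    constructor
    · obtain ⟨m, rfl⟩ := Nat.exists_eq_add_of_le' hn
      simp [Finset.sum_range_succ', hc]
    · simp
      linarith)
  exact ⟨r, h0, h1, sub_eq_zero.1 hr⟩

/-- At the root, `r T'(r) = c ∑ (n - j) r ^ j > 0`. -/
theorem rootMultiplicity_eq_one_of_pos {n : ℕ} {ρ r : ℝ} (hn : 1 ≤ n) (hρ : 0 < ρ) (hr : 0 < r)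
    (hroot : r ^ n = ρ / n * ∑ j ∈ Finset.range n, r ^ j) :
    (recMatrix n ρ).charpoly.rootMultiplicity r = 1 := by
  have hp : (recMatrix n ρ).charpoly ≠ 0 := (Matrix.charpoly_monic _).ne_zero
  have h1 : 0 < (recMatrix n ρ).charpoly.rootMultiplicity r :=
    (rootMultiplicity_pos hp).2 (recMatrix_isRoot_iff.2 hroot)
  have hn' : (0 : ℝ) < n := by exact_mod_cast hn
  have hder : ¬ 1 < (recMatrix n ρ).charpoly.rootMultiplicity r := by
    rw [one_lt_rootMultiplicity_iff_isRoot hp]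
    rintro ⟨-, h⟩
    rw [recMatrix_charpoly, IsRoot.def] at h
    simp only [derivative_sub, derivative_X_pow, derivative_C_mul, derivative_sum, eval_sub,
      eval_mul, eval_C, eval_finsetSum, eval_pow, eval_X] at h
    have hmul : ∀ k : ℕ, r * ((k : ℝ) * r ^ (k - 1)) = k * r ^ k := by
      rintro (_ | k)
      · simp
      · simp only [Nat.add_sub_cancel]; ring
    have h2 : (n : ℝ) * r ^ n - ρ / n * ∑ j ∈ Finset.range n, (j : ℝ) * r ^ j = 0 := by
      rw [← hmul n, Finset.sum_congr rfl fun j _ => (hmul j).symm, ← Finset.mul_sum]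
      linear_combination r * h
    have h3 : ∑ j ∈ Finset.range n, (j : ℝ) * r ^ j < ∑ j ∈ Finset.range n, (n : ℝ) * r ^ j := by
      refine Finset.sum_lt_sum_of_nonempty (Finset.nonempty_range_iff.2 (by omega))
        fun j hj => ?_
      have : (j : ℝ) < n := by exact_mod_cast Finset.mem_range.1 hj
      gcongr
    rw [← Finset.mul_sum] at h3
    have h4 := mul_lt_mul_of_pos_left h3 (div_pos hρ hn')
    rw [hroot] at h2
    linarith
  omega

theorem matSpectralRadius_recMatrix {n : ℕ} {ρ r : ℝ} (hn : 1 ≤ n) (hρ : 0 < ρ) (hr : 0 < r)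
    (hroot : r ^ n = ρ / n * ∑ j ∈ Finset.range n, r ^ j) :
    matSpectralRadius (recMatrix n ρ) = r := by
  have hn' : (0 : ℝ) < n := by exact_mod_cast hn
  have key : spectralRadius ℂ ((recMatrix n ρ).map (algebraMap ℝ ℂ)) = ENNReal.ofReal r := by
    apply le_antisymm
    · refine iSup₂_le fun z hz => ?_
      rw [Matrix.mem_spectrum_iff_isRoot_charpoly, recMatrix_map_isRoot_iff] at hz
      rw [ENNReal.ofReal, ENNReal.coe_le_coe, Real.le_toNNReal_iff_coe_le hr.le, coe_nnnorm]
      refine le_of_pow_le_geom_sum hn (div_pos hρ hn') hr hroot ?_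
      rw [← norm_pow, hz, norm_mul, Complex.norm_real, Real.norm_of_nonneg (by positivity)]
      gcongr
      exact (norm_sum_le _ _).trans_eq (by simp)
    · have hz : (r : ℂ) ∈ spectrum ℂ ((recMatrix n ρ).map (algebraMap ℝ ℂ)) := by
        rw [Matrix.mem_spectrum_iff_isRoot_charpoly, recMatrix_map_isRoot_iff]
        exact_mod_cast hroot
      refine le_trans (le_of_eq ?_) (le_iSup₂ (f := fun (k : ℂ) _ => (‖k‖₊ : ENNReal)) (r : ℂ) hz)
      rw [ENNReal.ofReal, ENNReal.coe_inj]
      ext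
      simp [hr.le, abs_of_pos hr]
  rw [matSpectralRadius, key, ENNReal.toReal_ofReal hr.le]

/-! ### Convergence of iterated weighted averages -/

theorem add_mul_sub_le_weighted_sum {n : ℕ} {w v : ℕ → ℝ} {w₀ a : ℝ} {i : ℕ} (hw₀ : 0 ≤ w₀)
    (hw : ∀ j < n, w₀ ≤ w j) (hsum : ∑ j ∈ Finset.range n, w j = 1)
    (hv : ∀ j < n, a ≤ v j) (hi : i < n) :
    a + w₀ * (v i - a) ≤ ∑ j ∈ Finset.range n, w j * v j := by
  have h1 : ∑ j ∈ Finset.range n, w j * (v j - a) = ∑ j ∈ Finset.range n, w j * v j - a := by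
    simp only [mul_sub, Finset.sum_sub_distrib, ← Finset.sum_mul, hsum, one_mul]
  have h2 : w i * (v i - a) ≤ ∑ j ∈ Finset.range n, w j * (v j - a) :=
    Finset.single_le_sum (f := fun j => w j * (v j - a)) (fun j hj =>
      mul_nonneg (hw₀.trans (hw j (Finset.mem_range.1 hj)))
        (sub_nonneg.2 (hv j (Finset.mem_range.1 hj)))) (Finset.mem_range.2 hi)
  have h3 := mul_le_mul_of_nonneg_right (hw i hi) (sub_nonneg.2 (hv i hi))
  linarith

section WeightedAverage

variable {n : ℕ} {w e : ℕ → ℝ} {w₀ : ℝ}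

theorem le_of_window_le {a : ℝ} {s : ℕ} (hn : 1 ≤ n) (hw₀ : 0 ≤ w₀)
    (hw : ∀ j < n, w₀ ≤ w j) (hsum : ∑ j ∈ Finset.range n, w j = 1)
    (he : ∀ m, e (m + n) = ∑ j ∈ Finset.range n, w j * e (m + j))
    (ha : ∀ j < n, a ≤ e (s + j)) (m : ℕ) (hm : s ≤ m) : a ≤ e m := by
  obtain ⟨k, rfl⟩ := Nat.exists_eq_add_of_le hm
  clear hm
  induction k using Nat.strong_induction_on with
  | _ k ih =>
    by_cases hk : k < n
    · exact ha k hk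
    · obtain ⟨q, rfl⟩ := Nat.exists_eq_add_of_le' (not_lt.1 hk)
      have hv : ∀ j < n, a ≤ e (s + q + j) := fun j hj => by
        rw [add_assoc]; exact ih (q + j) (by omega)
      have := add_mul_sub_le_weighted_sum (v := fun j => e (s + q + j)) hw₀ hw hsum hv
        (i := 0) (by omega)
      rw [← add_assoc, he]
      have h2 := mul_nonneg hw₀ (sub_nonneg.2 (hv 0 (by omega)))
      linarith

/-- The single term `e (s + n - 1)` lies in the window of each of the next `n` terms, so its excess
over `a` lifts them all, and hence everything later. -/
theorem add_mul_sub_le_of_le {a : ℝ} {s : ℕ} (hn : 1 ≤ n) (hw₀ : 0 ≤ w₀)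
    (hw : ∀ j < n, w₀ ≤ w j) (hsum : ∑ j ∈ Finset.range n, w j = 1)
    (he : ∀ m, e (m + n) = ∑ j ∈ Finset.range n, w j * e (m + j))
    (ha : ∀ m, s ≤ m → a ≤ e m) (m : ℕ) (hm : s + n ≤ m) :
    a + w₀ * (e (s + n - 1) - a) ≤ e m := by
  refine le_of_window_le (s := s + n) hn hw₀ hw hsum he (fun j hj => ?_) m hm
  have := add_mul_sub_le_weighted_sum (v := fun i => e (s + j + i)) (i := n - 1 - j) hw₀ hw hsum
    (fun i _ => ha _ (by omega)) (by omega)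
  rw [show s + n + j = s + j + n by omega, he]
  rwa [show s + j + (n - 1 - j) = s + n - 1 by omega] at this

/-- A sequence each of whose terms is a fixed strictly positive weighted average of its `n`
predecessors converges. -/
theorem exists_tendsto_of_weighted_average (hn : 1 ≤ n) (hw₀ : 0 < w₀)
    (hw : ∀ j < n, w₀ ≤ w j) (hsum : ∑ j ∈ Finset.range n, w j = 1)
    (he : ∀ m, e (m + n) = ∑ j ∈ Finset.range n, w j * e (m + j)) :
    ∃ l, Tendsto e atTop (𝓝 l) := by
  have he' : ∀ m, (-e) (m + n) = ∑ j ∈ Finset.range n, w j * (-e) (m + j) := fun m => by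
    simp [he]
  have hw1 : w₀ ≤ 1 := by
    rw [← hsum]
    exact (hw 0 (by omega)).trans (Finset.single_le_sum
      (fun j hj => hw₀.le.trans (hw j (Finset.mem_range.1 hj))) (Finset.mem_range.2 hn))
  have hne : (Finset.range n).Nonempty := Finset.nonempty_range_iff.2 (by omega)
  obtain ⟨a₀, ha₀⟩ : ∃ a, ∀ j < n, a ≤ e (0 + j) :=
    ⟨(Finset.range n).inf' hne e, fun j hj => by
      rw [zero_add]; exact Finset.inf'_le _ (Finset.mem_range.2 hj)⟩
  obtain ⟨b₀, hb₀⟩ : ∃ b, ∀ j < n, b ≤ (-e) (0 + j) :=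
    ⟨(Finset.range n).inf' hne (-e), fun j hj => by
      rw [zero_add]; exact Finset.inf'_le _ (Finset.mem_range.2 hj)⟩
  -- Here `a` and `-b` are lower and upper bounds of a tail. Both are improved by means of the same
  -- term, so the two gains add up to `w₀` times the gap.
  have hstep : ∀ k : ℕ, ∃ a b : ℝ, -b - a ≤ (1 - w₀) ^ k * (-b₀ - a₀) ∧
      (∀ m, k * n ≤ m → a ≤ e m) ∧ ∀ m, k * n ≤ m → b ≤ (-e) m := by
    intro k
    induction k with
    | zero =>
      exact ⟨a₀, b₀, by simp, fun m _ => le_of_window_le hn hw₀.le hw hsum he ha₀ m (by omega),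
        fun m _ => le_of_window_le hn hw₀.le hw hsum he' hb₀ m (by omega)⟩
    | succ k ih =>
      obtain ⟨a, b, hab, ha, hb⟩ := ih
      refine ⟨_, _, ?_, fun m hm => add_mul_sub_le_of_le hn hw₀.le hw hsum he ha m
        (by rw [add_mul] at hm; omega), fun m hm => add_mul_sub_le_of_le hn hw₀.le hw hsum he' hb m
        (by rw [add_mul] at hm; omega)⟩
      have := mul_le_mul_of_nonneg_left hab (sub_nonneg.2 hw1)
      rw [pow_succ]
      simp only [Pi.neg_apply]
      linarith
  have hlim : Tendsto (fun k : ℕ => (1 - w₀) ^ k * (-b₀ - a₀)) atTop (𝓝 0) := by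
    simpa using (tendsto_pow_atTop_nhds_zero_of_lt_one (sub_nonneg.2 hw1)
      (by linarith)).mul_const (-b₀ - a₀)
  refine cauchySeq_tendsto_of_complete (Metric.cauchySeq_iff.2 fun ε hε => ?_)
  obtain ⟨k, hk⟩ := (hlim.eventually_lt_const hε).exists
  obtain ⟨a, b, hab, ha, hb⟩ := hstep k
  refine ⟨k * n, fun i hi j hj => ?_⟩
  have h1 := ha i hi
  have h2 := ha j hj
  have h3 := hb i hi
  have h4 := hb j hj
  simp only [Pi.neg_apply] at h3 h4
  rw [Real.dist_eq, abs_lt]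
  constructor <;> linarith

end WeightedAverage

/-! ### Ratio limit for the recurrence -/

theorem IsAveragingSeq.nonneg {n : ℕ} {ρ : ℝ} {d : ℕ → ℝ} (h : IsAveragingSeq n ρ d)
    (hρ : 0 ≤ ρ) (h0 : ∀ j < n, 0 ≤ d j) (k : ℕ) : 0 ≤ d k := by
  induction k using Nat.strong_induction_on with
  | _ k ih =>
    by_cases hk : k < n
    · exact h0 k hk
    · obtain ⟨m, rfl⟩ := Nat.exists_eq_add_of_le' (not_lt.1 hk)
      rw [h m]
      have : 0 ≤ ∑ j ∈ Finset.range n, d (m + j) :=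
        Finset.sum_nonneg fun j hj => ih _ (by have := Finset.mem_range.1 hj; omega)
      positivity

theorem IsAveragingSeq.pos {n : ℕ} {ρ : ℝ} {d : ℕ → ℝ} (h : IsAveragingSeq n ρ d)
    (hρ : 0 < ρ) (h0 : ∀ j < n, 0 ≤ d j) (hne : ∃ j < n, d j ≠ 0) (m : ℕ) : 0 < d (m + n) := by
  have hd := h.nonneg hρ.le h0
  have hstep : ∀ m, (∃ j < n, 0 < d (m + j)) → 0 < d (m + n) := by
    rintro m ⟨j, hj, hpos⟩
    rw [h m]
    have hn : (0 : ℝ) < n := by exact_mod_cast (by omega : 0 < n)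
    have : 0 < ∑ j ∈ Finset.range n, d (m + j) :=
      Finset.sum_pos' (fun j _ => hd _) ⟨j, Finset.mem_range.2 hj, hpos⟩
    positivity
  induction m with
  | zero =>
    obtain ⟨j, hj, hjne⟩ := hne
    exact hstep 0 ⟨j, hj, by rw [zero_add]; exact (h0 j hj).lt_of_ne' hjne⟩
  | succ m ih =>
    obtain ⟨j, hj, -⟩ := hne
    exact hstep _ ⟨n - 1, by omega, by rwa [show m + 1 + (n - 1) = m + n by omega]⟩

theorem IsAveragingSeq.tendsto_ratio {n : ℕ} {ρ r : ℝ} {d : ℕ → ℝ} (h : IsAveragingSeq n ρ d)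
    (hn : 1 ≤ n) (hρ : 0 < ρ) (hr : 0 < r) (hr1 : r < 1)
    (hroot : r ^ n = ρ / n * ∑ j ∈ Finset.range n, r ^ j)
    (h0 : ∀ j < n, 0 ≤ d j) (hne : ∃ j < n, d j ≠ 0) :
    Tendsto (fun k => d (k + 1) / d k) atTop (𝓝 r) := by
  have hn' : (0 : ℝ) < n := by exact_mod_cast hn
  set c := ρ / n with hc
  have hcpos : 0 < c := div_pos hρ hn'
  set e : ℕ → ℝ := fun k => d k / r ^ k with hedef
  set w : ℕ → ℝ := fun j => c * r ^ j / r ^ n with hwdef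
  have hw₀ : 0 < c := hcpos
  -- Since `r < 1`, the factor `r ^ j / r ^ n` is at least one.
  have hw : ∀ j < n, c ≤ w j := fun j hj => by
    rw [hwdef, le_div_iff₀ (by positivity)]
    exact mul_le_mul_of_nonneg_left (pow_le_pow_of_le_one hr.le hr1.le hj.le) hcpos.le
  have hsum : ∑ j ∈ Finset.range n, w j = 1 := by
    rw [← Finset.sum_div, ← Finset.mul_sum, ← hroot]
    exact div_self (pow_pos hr n).ne'
  have he : ∀ m, e (m + n) = ∑ j ∈ Finset.range n, w j * e (m + j) := fun m => by
    have : ∀ j, w j * e (m + j) = c * d (m + j) / r ^ (m + n) := fun j => by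
      simp only [hwdef, hedef, pow_add]
      field_simp
    simp only [this]
    rw [← Finset.sum_div, ← Finset.mul_sum]
    simp only [hedef, h m, hc]
    ring
  obtain ⟨l, hl⟩ := exists_tendsto_of_weighted_average hn hw₀ hw hsum he
  have hne' : (Finset.range n).Nonempty := Finset.nonempty_range_iff.2 (by omega)
  have hepos : ∀ m, 0 < e (m + n) := fun m => div_pos (h.pos hρ h0 hne m) (by positivity)
  -- The minimum over the first window of positive terms bounds the limit from below.
  have hlpos : 0 < l := by
    have ha : 0 < (Finset.range n).inf' hne' (fun j => e (j + n)) :=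
      (Finset.lt_inf'_iff _).2 fun j _ => hepos j
    refine ha.trans_le (ge_of_tendsto hl ?_)
    filter_upwards [eventually_ge_atTop n] with m hm
    refine le_of_window_le hn hw₀.le hw hsum he (fun j hj => ?_) m hm
    rw [add_comm]
    exact Finset.inf'_le (f := fun j => e (j + n)) (Finset.mem_range.2 hj)
  have hlim := ((hl.comp (tendsto_add_atTop_nat 1)).div hl hlpos.ne').const_mul r
  rw [div_self hlpos.ne', mul_one] at hlim
  refine hlim.congr fun k => ?_
  simp only [hedef, Pi.div_apply, Function.comp_apply, pow_succ]
  -- An initial value may vanish; both quotients are then zero by convention.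
  by_cases hd : d k = 0
  · simp [hd]
  · field_simp

/-! ### Contraction of a gradient step -/

section Convex

variable {E : Type*} [NormedAddCommGroup E] [InnerProductSpace ℝ E] [CompleteSpace E]

/-- Along the ray from `y` through `x`, `f` minus the quadratic model has nonnegative derivative. No
sign is imposed on `m`, so the upper bound follows by passing to `-f`. -/
theorem quadratic_lower_bound_of_monotone {f : E → ℝ} {G : E → E} {m : ℝ}
    (hf : ∀ x, HasGradientAt f (G x) x)
    (hmono : ∀ x y, m * ‖x - y‖ ^ 2 ≤ inner ℝ (G x - G y) (x - y)) (x y : E) :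
    f y + inner ℝ (G y) (x - y) + m / 2 * ‖x - y‖ ^ 2 ≤ f x := by
  set v := x - y with hv
  set g : ℝ → ℝ := fun t =>
    f (y + t • v) - t * inner ℝ (G y) v - m / 2 * ‖v‖ ^ 2 * t ^ 2 with hg
  have hder : ∀ t, HasDerivAt g
      (inner ℝ (G (y + t • v)) v - inner ℝ (G y) v - m * ‖v‖ ^ 2 * t) t := by
    intro t
    have h1 : HasDerivAt (fun t : ℝ => y + t • v) v t := by
      simpa using ((hasDerivAt_id t).smul_const v).const_add y
    have h2 : HasDerivAt (fun t : ℝ => f (y + t • v)) (inner ℝ (G (y + t • v)) v) t := by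
      simpa [Function.comp_def] using (hf (y + t • v)).hasFDerivAt.comp_hasDerivAt t h1
    have h3 := (h2.sub ((hasDerivAt_id t).mul_const (inner ℝ (G y) v))).sub
      (((hasDerivAt_id t).pow 2).const_mul (m / 2 * ‖v‖ ^ 2))
    refine h3.congr_deriv ?_
    simp
    ring
  have hmon : MonotoneOn g (Set.Ici 0) := by
    refine monotoneOn_of_deriv_nonneg (convex_Ici 0)
      (fun t _ => (hder t).continuousAt.continuousWithinAt)
      (fun t _ => (hder t).differentiableAt.differentiableWithinAt) fun t ht => ?_
    rw [interior_Ici, Set.mem_Ioi] at ht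
    rw [(hder t).deriv]
    have h := hmono (y + t • v) y
    rw [add_sub_cancel_left, norm_smul, inner_smul_right, inner_sub_left, Real.norm_eq_abs,
      abs_of_pos ht] at h
    have h' : t * (m * ‖v‖ ^ 2 * t) ≤ t * (inner ℝ (G (y + t • v)) v - inner ℝ (G y) v) := by
      linarith
    have := le_of_mul_le_mul_left h' ht
    linarith
  have h01 := hmon (Set.mem_Ici.2 le_rfl) (Set.mem_Ici.2 zero_le_one) zero_le_one
  simp only [hg, zero_smul, one_smul, add_zero, hv, add_sub_cancel] at h01
  norm_num at h01
  linarith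

theorem quadratic_upper_bound_of_monotone {f : E → ℝ} {G : E → E} {M : ℝ}
    (hf : ∀ x, HasGradientAt f (G x) x)
    (hM : ∀ x y, inner ℝ (G x - G y) (x - y) ≤ M * ‖x - y‖ ^ 2) (x y : E) :
    f x ≤ f y + inner ℝ (G y) (x - y) + M / 2 * ‖x - y‖ ^ 2 := by
  have hneg : ∀ x, HasGradientAt (fun z => -f z) (-G x) x := fun x => by
    rw [hasGradientAt_iff_hasFDerivAt, map_neg]
    exact (hf x).hasFDerivAt.neg
  have := quadratic_lower_bound_of_monotone (m := -M) hneg (fun x y => by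
    have := hM x y
    rw [neg_sub_neg, ← neg_sub (G x), inner_neg_left]
    linarith) x y
  rw [inner_neg_left] at this
  linarith

/-- Cocoercivity of the gradient of a smooth convex function (Baillon–Haddad). -/
theorem norm_sq_gradient_sub_le {φ : E → ℝ} {P : E → E} {M : ℝ} (hM : 0 < M)
    (hφ : ∀ x, HasGradientAt φ (P x) x)
    (hlo : ∀ x y, 0 ≤ inner ℝ (P x - P y) (x - y))
    (hup : ∀ x y, inner ℝ (P x - P y) (x - y) ≤ M * ‖x - y‖ ^ 2) (x y : E) :
    ‖P x - P y‖ ^ 2 ≤ M * inner ℝ (P x - P y) (x - y) := by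
  have half : ∀ x y, φ x + inner ℝ (P x) (y - x) + 1 / (2 * M) * ‖P x - P y‖ ^ 2 ≤ φ y := by
    intro x y
    set q := P x - P y with hq
    -- The point `y + q / M` minimizes the quadratic upper model at `y` of `φ - ⟨P x, ·⟩`, whose
    -- gradient at `y` is `-q`.
    have h1 := quadratic_lower_bound_of_monotone (m := 0) hφ (by simpa using hlo)
      (y + (1 / M) • q) x
    have h2 := quadratic_upper_bound_of_monotone hφ hup (y + (1 / M) • q) y
    rw [add_sub_cancel_left, norm_smul, inner_smul_right, Real.norm_of_nonneg (by positivity)] at h2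
    rw [show y + (1 / M) • q - x = (y - x) + (1 / M) • q by abel, inner_add_right,
      inner_smul_right] at h1
    have h3 : inner ℝ (P x) q - inner ℝ (P y) q = ‖q‖ ^ 2 := by
      rw [← inner_sub_left, ← hq, real_inner_self_eq_norm_sq]
    have h4 : M / 2 * (1 / M * ‖q‖) ^ 2 = 1 / (2 * M) * ‖q‖ ^ 2 := by field_simp
    have h5 : 1 / M * inner ℝ (P x) q - 1 / M * inner ℝ (P y) q = 2 * (1 / (2 * M) * ‖q‖ ^ 2) := by
      rw [← mul_sub, h3]; field_simp
    linarith
  have h1 := half x y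
  have h2 := half y x
  rw [norm_sub_rev (P y)] at h2
  have h3 : inner ℝ (P x) (y - x) + inner ℝ (P y) (x - y) = -inner ℝ (P x - P y) (x - y) := by
    rw [← neg_sub x y, inner_neg_right, inner_sub_left]; ring
  have h4 : 1 / M * ‖P x - P y‖ ^ 2 ≤ inner ℝ (P x - P y) (x - y) := by
    have : 1 / M * ‖P x - P y‖ ^ 2 = 2 * (1 / (2 * M) * ‖P x - P y‖ ^ 2) := by field_simp
    linarith
  have h5 := mul_le_mul_of_nonneg_left h4 hM.le
  rwa [← mul_assoc, mul_one_div_cancel hM.ne', one_mul] at h5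

end Convex

/-- Removing `μ / 2 * ‖z‖ ^ 2` leaves a convex function with cocoercive gradient `P` of constant `L
- μ`. The step difference becomes `ρ • (x - y) - ε • q`; as `ε (L - μ) = 2 ρ`, cocoercivity makes
the cross term absorb `ε ^ 2 * ‖q‖ ^ 2`. -/
theorem IsSmoothStronglyConvex.norm_gradient_step_le {p : ℕ} {μ L : ℝ}
    {f : EuclideanSpace ℝ (Fin p) → ℝ} (hf : IsSmoothStronglyConvex μ L f) (hμ : 0 < μ)
    (hL : μ < L) (x y : EuclideanSpace ℝ (Fin p)) :
    ‖(x - y) - (2 / (μ + L)) • (gradient f x - gradient f y)‖ ≤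
      (L - μ) / (L + μ) * ‖x - y‖ := by
  have hLμ : 0 < L + μ := by linarith
  set P : EuclideanSpace ℝ (Fin p) → EuclideanSpace ℝ (Fin p) :=
    fun z => gradient f z - μ • z with hP
  have hPsub : ∀ x y, P x - P y = (gradient f x - gradient f y) - μ • (x - y) := fun x y => by
    simp only [hP, smul_sub]; abel
  have hφ : ∀ z, HasGradientAt (fun z => f z - μ / 2 * ‖z‖ ^ 2) (P z) z := fun z => by
    rw [hasGradientAt_iff_hasFDerivAt]
    refine ((hf.differentiable z).hasGradientAt.hasFDerivAt.sub
      ((hasStrictFDerivAt_norm_sq z).hasFDerivAt.const_mul (μ / 2))).congr_fderiv ?_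
    ext v
    simp [hP]
    ring
  have hinner : ∀ x y, inner ℝ (P x - P y) (x - y) =
      inner ℝ (gradient f x - gradient f y) (x - y) - μ * ‖x - y‖ ^ 2 := fun x y => by
    rw [hPsub, inner_sub_left, inner_smul_left, real_inner_self_eq_norm_sq]
    simp
  have hco := norm_sq_gradient_sub_le (sub_pos.2 hL) hφ
    (fun x y => by rw [hinner]; linarith [hf.strong x y])
    (fun x y => by
      rw [hinner]
      have h1 := real_inner_le_norm (gradient f x - gradient f y) (x - y)
      have h2 := mul_le_mul_of_nonneg_right (hf.lipschitz x y) (norm_nonneg (x - y))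
      nlinarith) x y
  set q := P x - P y with hq
  set ρ := (L - μ) / (L + μ) with hρ
  have hρ0 : 0 ≤ ρ := div_nonneg (by linarith) hLμ.le
  set ε := 2 / (μ + L) with hε
  have hε0 : 0 ≤ ε := div_nonneg zero_le_two (by linarith)
  have hεL : ε * (L - μ) = 2 * ρ := by
    rw [hε, hρ, add_comm μ L]; field_simp
  have hερ : 1 - ε * μ = ρ := by
    rw [hε, hρ, add_comm μ L]; field_simp; ring
  have hvec : (x - y) - ε • (gradient f x - gradient f y) = ρ • (x - y) - ε • q := by
    rw [hPsub] at hq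
    rw [hq, ← hερ]
    module
  refine abs_le_of_sq_le_sq' ?_ (mul_nonneg hρ0 (norm_nonneg _)) |>.2
  rw [hvec, norm_sub_sq_real, norm_smul, norm_smul, inner_smul_left, inner_smul_right,
    Real.norm_of_nonneg hρ0, Real.norm_of_nonneg hε0, real_inner_comm]
  simp only [conj_trivial]
  have h1 := mul_le_mul_of_nonneg_left hco (mul_nonneg hε0 hε0)
  have h2 : ε * ε * ((L - μ) * inner ℝ q (x - y)) = 2 * (ρ * (ε * inner ℝ q (x - y))) := by
    linear_combination (ε * inner ℝ q (x - y)) * hεL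
  linarith

/-! ### The incremental method -/

/-- The slot is `j - 1` modulo `n`, written at step `j - 1` and left alone for the next `n - 1`
steps. For `j = 0` every slot initially holds `x₀`. -/
theorem diagState_copy {n p : ℕ} (hn : 1 ≤ n) (f : Fin n → EuclideanSpace ℝ (Fin p) → ℝ) (ε : ℝ)
    (x₀ : EuclideanSpace ℝ (Fin p)) (j r : ℕ) (hr : r < n) (i : Fin n)
    (hi : i.val = (j + (n - 1)) % n) :
    (diagState f ε x₀ (j + r)).2 i = diagIterate f ε x₀ j := by
  induction r with
  | zero =>
    rcases j with _ | k
    · simp [diagState, diagIterate]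
    · have : i.val = k % n := by
        rw [hi, show k + 1 + (n - 1) = k + n by omega, Nat.add_mod_right]
      simp [diagState, diagIterate, this]
  | succ r ih =>
    have hne : i.val ≠ (j + r) % n := by
      rw [hi]
      intro h
      have h1 : n - 1 ≡ r [MOD n] := Nat.ModEq.add_left_cancel' j h
      have h2 := Nat.ModEq.eq_of_lt_of_lt h1 (by omega) (by omega)
      omega
    rw [← add_assoc, ← ih (by omega)]
    simp [diagState, hne]

/-- From step `n - 1` on, the stored copies are the last `n` iterates. -/
theorem sum_diagState_copies {n p : ℕ} (hn : 1 ≤ n) (f : Fin n → EuclideanSpace ℝ (Fin p) → ℝ)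
    (ε : ℝ) (x₀ : EuclideanSpace ℝ (Fin p)) (m : ℕ) (F : EuclideanSpace ℝ (Fin p) → ℝ) :
    ∑ i, F ((diagState f ε x₀ (m + (n - 1))).2 i) =
      ∑ j ∈ Finset.range n, F (diagIterate f ε x₀ (m + j)) := by
  rw [Finset.sum_range]
  -- `σ j` is the slot that holds iterate `m + j`.
  let σ : Fin n → Fin n := fun j => ⟨(m + j + (n - 1)) % n, Nat.mod_lt _ (by omega)⟩
  have hσ : Function.Injective σ := fun a b hab => by
    have h1 : m + a + (n - 1) ≡ m + b + (n - 1) [MOD n] := congrArg Fin.val hab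
    have h2 := Nat.ModEq.add_left_cancel' m (Nat.ModEq.add_right_cancel' (n - 1) h1)
    exact Fin.ext (Nat.ModEq.eq_of_lt_of_lt h2 a.2 b.2)
  rw [← (Finite.injective_iff_bijective.1 hσ).sum_comp]
  refine Finset.sum_congr rfl fun j _ => ?_
  rw [← diagState_copy hn f ε x₀ (m + j) (n - 1 - j) (by omega) (σ j) rfl,
    show m + (j : ℕ) + (n - 1 - j) = m + (n - 1) by omega]

theorem sum_gradient_eq_zero {n p : ℕ} (hn : 1 ≤ n) {f : Fin n → EuclideanSpace ℝ (Fin p) → ℝ}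
    {xstar : EuclideanSpace ℝ (Fin p)} (hf : ∀ i, Differentiable ℝ (f i))
    (hmin : ∀ x, (1 / (n : ℝ)) * ∑ i, f i xstar ≤ (1 / (n : ℝ)) * ∑ i, f i x) :
    ∑ i, gradient (f i) xstar = 0 := by
  have hn' : (0 : ℝ) < 1 / n := by
    have : (0 : ℝ) < n := by exact_mod_cast hn
    positivity
  have hloc : IsLocalMin (fun x => ∑ i, f i x) xstar :=
    Eventually.of_forall fun x => le_of_mul_le_mul_left (hmin x) hn'
  have hder := HasFDerivAt.fun_sum (u := Finset.univ)
    fun i _ => (hf i xstar).hasGradientAt.hasFDerivAt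
  have := hloc.hasFDerivAt_eq_zero hder
  rwa [← map_sum, map_eq_zero_iff _ (LinearIsometryEquiv.injective _)] at this

theorem norm_diagIterate_sub_le {n p : ℕ} (hn : 1 ≤ n) {μ L : ℝ}
    {f : Fin n → EuclideanSpace ℝ (Fin p) → ℝ} {x₀ xstar : EuclideanSpace ℝ (Fin p)}
    (hμ : 0 < μ) (hL : μ < L) (hf : ∀ i, IsSmoothStronglyConvex μ L (f i))
    (hmin : ∀ x, (1 / (n : ℝ)) * ∑ i, f i xstar ≤ (1 / (n : ℝ)) * ∑ i, f i x) (m : ℕ) :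
    ‖diagIterate f (2 / (μ + L)) x₀ (m + n) - xstar‖ ≤
      (L - μ) / (L + μ) *
        ((∑ j ∈ Finset.range n, ‖diagIterate f (2 / (μ + L)) x₀ (m + j) - xstar‖) / n) := by
  have hn' : (0 : ℝ) < n := by exact_mod_cast hn
  have hgrad := sum_gradient_eq_zero hn (fun i => (hf i).differentiable) hmin
  set ε := 2 / (μ + L) with hε
  set y := (diagState f ε x₀ (m + (n - 1))).2 with hy
  have hx : diagIterate f ε x₀ (m + n) =
      (1 / (n : ℝ)) • ∑ i, y i - (ε / (n : ℝ)) • ∑ i, gradient (f i) (y i) := by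
    rw [show m + n = m + (n - 1) + 1 by omega]
    rfl
  -- The gradients at `xstar` sum to zero, so subtracting them turns the error into a mean of
  -- gradient-step differences.
  have hdiff : diagIterate f ε x₀ (m + n) - xstar = (1 / (n : ℝ)) •
      ∑ i, ((y i - xstar) - ε • (gradient (f i) (y i) - gradient (f i) xstar)) := by
    rw [hx, Finset.sum_sub_distrib, Finset.sum_sub_distrib, ← Finset.smul_sum,
      Finset.sum_sub_distrib, hgrad, sub_zero, Finset.sum_const, Finset.card_univ,
      Fintype.card_fin, smul_sub, smul_sub, ← Nat.cast_smul_eq_nsmul ℝ n xstar, smul_smul,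
      smul_smul, one_div_mul_cancel hn'.ne', one_smul, one_div_mul_eq_div]
    abel
  rw [hdiff, norm_smul, Real.norm_of_nonneg (by positivity),
    ← sum_diagState_copies hn f ε x₀ m (fun z => ‖z - xstar‖), ← hy]
  calc 1 / (n : ℝ) * ‖∑ i, ((y i - xstar) - ε • (gradient (f i) (y i) - gradient (f i) xstar))‖
      ≤ 1 / (n : ℝ) * ∑ i, (L - μ) / (L + μ) * ‖y i - xstar‖ := by
        gcongr
        exact norm_sum_le_of_le _ fun i _ => (hf i).norm_gradient_step_le hμ hL _ _
    _ = _ := by rw [← Finset.mul_sum]; ring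

/-! ### Assembly -/

theorem theorem9 (n : ℕ) (hn : 1 ≤ n) (κ ρ lam : ℝ) (hκ : 1 < κ)
    (hρ : ρ = (κ - 1) / (κ + 1)) (hlam : lam = matSpectralRadius (recMatrix n ρ)) :
    -- (i) largest real root of the characteristic polynomial, and a simple root
    (IsGreatest {t : ℝ | (recMatrix n ρ).charpoly.IsRoot t} lam ∧
      (recMatrix n ρ).charpoly.rootMultiplicity lam = 1) ∧
    -- (ii) ratio limit, for all nonnegative initial values that do not all vanish
    (∀ d : ℕ → ℝ, IsAveragingSeq n ρ d → (∀ j < n, 0 ≤ d j) → (∃ j < n, d j ≠ 0) →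
      Tendsto (fun k => d (k + 1) / d k) atTop (𝓝 lam)) ∧
    -- (iii) lower and upper bound; the factor of a whole pass is below that of gradient descent
    (1 < n → ρ ≤ lam ∧ lam < ρ ^ (1 / (n : ℝ)) ∧ lam ^ n < ρ) ∧
    -- (iv) the largest, and in fact only, root of `h` in `[0, 1)`
    (IsGreatest {γ : ℝ | γ ∈ Set.Ico (0 : ℝ) 1 ∧ hFun n ρ γ = 0} lam ∧
      ∀ γ ∈ Set.Ico (0 : ℝ) 1, hFun n ρ γ = 0 → γ = lam) ∧
    -- the sequence started from the first `n` errors of the method bounds all its errors,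
    -- and has the asymptotic rate `lam`
    (∀ (p : ℕ) (μ L : ℝ) (f : Fin n → EuclideanSpace ℝ (Fin p) → ℝ)
      (x₀ xstar : EuclideanSpace ℝ (Fin p)) (d : ℕ → ℝ),
      0 < μ → κ = L / μ → (∀ i, IsSmoothStronglyConvex μ L (f i)) →
      (∀ x, (1 / (n : ℝ)) * ∑ i, f i xstar ≤ (1 / (n : ℝ)) * ∑ i, f i x) →
      IsAveragingSeq n ρ d →
      (∀ j < n, d j = ‖diagIterate f (2 / (μ + L)) x₀ j - xstar‖) →
      (∀ k, ‖diagIterate f (2 / (μ + L)) x₀ k - xstar‖ ≤ d k) ∧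
      (x₀ ≠ xstar → Tendsto (fun k => d (k + 1) / d k) atTop (𝓝 lam))) := by
  have hκ1 : 0 < κ + 1 := by linarith
  have hρ0 : 0 < ρ := hρ ▸ div_pos (by linarith) hκ1
  have hρ1 : ρ < 1 := by rw [hρ, div_lt_one hκ1]; linarith
  have hn' : (0 : ℝ) < n := by exact_mod_cast hn
  have hc : 0 < ρ / n := div_pos hρ0 hn'
  obtain ⟨r, hr0, hr1, hroot⟩ := exists_pow_eq_geom_sum hn hc (by
    rwa [mul_div_cancel₀ _ hn'.ne'])
  obtain rfl : lam = r := hlam.trans (matSpectralRadius_recMatrix hn hρ0 hr0 hroot)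
  have hratio : ∀ d : ℕ → ℝ, IsAveragingSeq n ρ d → (∀ j < n, 0 ≤ d j) → (∃ j < n, d j ≠ 0) →
      Tendsto (fun k => d (k + 1) / d k) atTop (𝓝 lam) := fun d hd h0 hne =>
    hd.tendsto_ratio hn hρ0 hr0 hr1 hroot h0 hne
  have huniq : ∀ γ ∈ Set.Ico (0 : ℝ) 1, hFun n ρ γ = 0 → γ = lam := by
    rintro γ ⟨hγ0, hγ1⟩ hγ
    rw [hFun_eq, mul_eq_zero, or_iff_right (by linarith), sub_eq_zero] at hγ
    have hγpos : 0 < γ := by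
      refine hγ0.lt_of_ne' ?_
      rintro rfl
      obtain ⟨m, rfl⟩ := Nat.exists_eq_add_of_le' hn
      refine hc.ne ?_
      simpa [Finset.sum_range_succ'] using hγ
    exact le_antisymm (le_of_pow_le_geom_sum hn hc hr0 hroot hγ.le)
      (le_of_pow_le_geom_sum hn hc hγpos hγ hroot.le)
  refine ⟨⟨⟨recMatrix_isRoot_iff.2 hroot, fun t ht => ?_⟩,
    rootMultiplicity_eq_one_of_pos hn hρ0 hr0 hroot⟩, hratio, fun hn1 => ?_,
    ⟨⟨⟨⟨hr0.le, hr1⟩, ?_⟩, fun γ hγ => (huniq γ hγ.1 hγ.2).le⟩, huniq⟩, ?_⟩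
  · exact le_of_pow_le_geom_sum hn hc hr0 hroot (recMatrix_isRoot_iff.1 ht).le
  · have hpow : lam ^ n < ρ := by
      have : ∑ j ∈ Finset.range n, lam ^ j < ∑ j ∈ Finset.range n, (1 : ℝ) :=
        Finset.sum_lt_sum (fun j _ => pow_le_one₀ hr0.le hr1.le)
          ⟨1, Finset.mem_range.2 hn1, by simpa using hr1⟩
      simp only [Finset.sum_const, Finset.card_range, nsmul_eq_mul, mul_one] at this
      calc lam ^ n = ρ / n * ∑ j ∈ Finset.range n, lam ^ j := hroot
        _ < ρ / n * n := by gcongr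
        _ = ρ := div_mul_cancel₀ _ hn'.ne'
    refine ⟨le_of_pow_le_geom_sum hn hc hr0 hroot ?_, ?_, hpow⟩
    -- Bounding each power below by `ρ ^ (n - 1)` gives `T(ρ) ≤ 0`, hence `ρ ≤ lam`.
    · have : ∑ j ∈ Finset.range n, ρ ^ (n - 1) ≤ ∑ j ∈ Finset.range n, ρ ^ j :=
        Finset.sum_le_sum fun j hj => pow_le_pow_of_le_one hρ0.le hρ1.le
          (by have := Finset.mem_range.1 hj; omega)
      simp only [Finset.sum_const, Finset.card_range, nsmul_eq_mul] at this
      calc ρ ^ n = ρ / n * (n * ρ ^ (n - 1)) := by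
            rw [← mul_assoc, div_mul_cancel₀ _ hn'.ne', mul_pow_sub_one (by omega)]
        _ ≤ _ := by gcongr
    · rw [one_div, Real.lt_rpow_inv_iff_of_pos hr0.le hρ0.le hn', Real.rpow_natCast]
      exact hpow
  · rw [hFun_eq, hroot, sub_self, mul_zero]
  · intro p μ L f x₀ xstar d hμ hκL hf hmin hd hinit
    have hL : μ < L := by rwa [hκL, one_lt_div hμ] at hκ
    have hρL : (L - μ) / (L + μ) = ρ := by
      rw [hρ, hκL]
      have : L + μ ≠ 0 := by linarith
      field_simp
    refine ⟨fun k => ?_, fun hx => hratio d hd (fun j hj => ?_) ⟨0, hn, ?_⟩⟩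
    · induction k using Nat.strong_induction_on with
      | _ k ih =>
        by_cases hk : k < n
        · exact (hinit k hk).ge
        · obtain ⟨m, rfl⟩ := Nat.exists_eq_add_of_le' (not_lt.1 hk)
          refine (norm_diagIterate_sub_le hn hμ hL hf hmin m).trans ?_
          rw [hd m, hρL]
          gcongr with j hj
          exact ih _ (by have := Finset.mem_range.1 hj; omega)
    · rw [hinit j hj]; exact norm_nonneg _
    · rw [hinit 0 hn, norm_ne_zero_iff, sub_ne_zero]
      exact hx
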